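/- Let $n \ge 2$ and $N \ge 0$ be integers. Write $\mathbb{S}^{n-1}$ for the unit sphere in Euclidean space $\mathbb{R}^n$, and let $d\sigma$ be normalized Lebesgue (surface) measure on $\mathbb{S}^{n-1}$, so that $\mathbb{S}^{n-1}$ has total mass $1$. For a continuous function $f : (\mathbb{S}^{n-1})^N \to \mathbb{R}$ put $$E f = \int f(\sigma_1,\dots,\sigma_N)\, d\sigma_1 \cdots d\sigma_N ,$$ the expectation of $f$ over $N$ independent, uniformly distributed spins. Let $\mathcal{E}$ be the set of functions on $(\mathbb{S}^{n-1})^N$ that are finite linear combinations, with non-negative coefficients, of monomials of the form $$\prod_{1\le i<j\le N} (\sigma_i\cdot\sigma_j)^{n_{ij}}, \qquad n_{ij} \in \{0,1,2,\dots\},$$ where $\sigma_i\cdot\sigma_j$ is the Euclidean inner product. Theorem (first and second Griffiths inequalities without interaction). If $f, g \in \mathcal{E}$, then $$E f \ge 0 \qquad\text{and}\qquad E(fg) \ge (E f)\,(E g).$$ -/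

import Mathlib

/-- The unit sphere `S^{n-1}` in Euclidean space `ℝⁿ`. -/
abbrev Spin (n : ℕ) : Type := Metric.sphere (0 : EuclideanSpace ℝ (Fin n)) 1

/-- Normalized surface (Lebesgue) measure on `S^{n-1}`: the surface measure
`MeasureTheory.Measure.toSphere` divided by its total mass. -/
noncomputable def spinMeasure (n : ℕ) : MeasureTheory.Measure (Spin n) :=
  ((MeasureTheory.volume : MeasureTheory.Measure (EuclideanSpace ℝ (Fin n))).toSphere Set.univ)⁻¹ •
    (MeasureTheory.volume : MeasureTheory.Measure (EuclideanSpace ℝ (Fin n))).toSphere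

/-- The expectation `E f = ∫ f(σ₁, …, σ_N) dσ₁ ⋯ dσ_N` of `N` independent uniform spins. -/
noncomputable def spinExpectation (N n : ℕ) (f : (Fin N → Spin n) → ℝ) : ℝ :=
  ∫ σ, f σ ∂(MeasureTheory.Measure.pi fun _ : Fin N => spinMeasure n)

/-- The monomial `∏_{i<j} (σ_i · σ_j)^{m_{ij}}` as a function of the spins. Only the exponents
`m i j` with `i < j` matter. -/
noncomputable def spinMonomial (N n : ℕ) (m : Fin N → Fin N → ℕ) (σ : Fin N → Spin n) : ℝ :=
  ∏ i : Fin N, ∏ j ∈ Finset.Ioi i,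
    inner ℝ (σ i : EuclideanSpace ℝ (Fin n)) (σ j : EuclideanSpace ℝ (Fin n)) ^ m i j

/-- The cone of all finite linear combinations, with nonnegative coefficients, of the monomials
`∏_{i<j} (σ_i · σ_j)^{m_{ij}}`. -/
noncomputable def spinCone (N n : ℕ) : PointedCone ℝ ((Fin N → Spin n) → ℝ) :=
  PointedCone.hull ℝ (Set.range (spinMonomial N n))

open MeasureTheory Set Metric
open scoped Pointwise NNReal

/-!
Both inequalities are proved for the larger cone `innerAlgebra N n`, the semiring of functions
generated by nonnegative constants and all inner products `⟪σ i, σ j⟫`.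

*Positivity.* In an orthonormal basis `e`, an element of `innerAlgebra N n` becomes a polynomial
with nonnegative coefficients in the coordinates `⟪e c, σ k⟫`. The mean of a monomial in the
coordinates factorizes over the spins, and each factor is an integral of even powers or vanishes
by reflection symmetry. This gives `E f ≥ 0`
(`spinExpectation_nonneg_of_mem_coordAlgebra`). Moreover, if a spin `s` is kept fixed and is taken
as one of the basis vectors, `⟪τ b, τ a⟫ - ⟪s, τ b⟫ ⟪s, τ a⟫` is the sum over the *other*
basis vectors of products of coordinates, so it has the same positivity property.

*Integrating out one spin.* Rotation invariance of the sphere gives the integration by parts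
formula (`integral_inner_mul_prod`)
`(n - 1 + |C|) ∫ ⟪s, w⟫ ∏_{c ∈ C} ⟪s, v c⟫ = ∑_{c ∈ C} ⟪w, v c⟫ ∫ ∏_{d ∈ C - c} ⟪s, v d⟫`.
Consider `f = ∏_{a ∈ A} ⟪s, τ a⟫` and `g = ∏_{b ∈ B} ⟪s, τ b⟫`, and let `E₁` be the mean over `s`.
Applying the formula to `f g` with `w = τ b` for one `b ∈ B`, and moving the contribution of `|A|`
to the right, gives
`(n - 2 + |B|) E₁(f g) = ∑_{a ∈ A} E₁((⟪τ b, τ a⟫ - ⟪s, τ b⟫ ⟪s, τ a⟫) ∏_{A - a} ∏_{B - b})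
  + ∑_{d ∈ B - b} ⟪τ b, τ d⟫ E₁(f ∏_{B - b - d})`.
The first sum has nonnegative mean even after multiplication by an element of the cone. The second
one reproduces, by induction on `|B|` and the same formula for `g` alone, the quantity
`(n - 2 + |B|) E₁ f E₁ g`. Hence `E (E₁ f · E₁ g) ≤ E (f g)`
(`spinExpectation_headMean_mul_headMean_le`). The formula also shows that `E₁` maps the cone of
`N + 1` spins to the cone of `N` spins, so the second inequality follows by induction on `N`.
-/

/-! ### Rotation invariance and integration by parts on the sphere -/

lemma isProbabilityMeasure_spinMeasure {n : ℕ} (hn : 2 ≤ n) :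
    IsProbabilityMeasure (spinMeasure n) := by
  have : NeZero n := ⟨by omega⟩
  constructor
  rw [spinMeasure, Measure.smul_apply, smul_eq_mul]
  exact ENNReal.inv_mul_cancel
    (by simpa only [ne_eq, Measure.measure_univ_eq_zero] using Measure.toSphere_ne_zero _)
    (measure_ne_top _ _)

/-- The action of a linear isometry on the unit sphere. -/
noncomputable def spinMap {n : ℕ} (e : EuclideanSpace ℝ (Fin n) ≃ₗᵢ[ℝ] EuclideanSpace ℝ (Fin n))
    (s : Spin n) : Spin n :=
  ⟨e s, by simp⟩

lemma continuous_spinMap {n : ℕ} (e : EuclideanSpace ℝ (Fin n) ≃ₗᵢ[ℝ] EuclideanSpace ℝ (Fin n)) :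
    Continuous (spinMap e) :=
  (e.continuous.comp continuous_subtype_val).subtype_mk _

/-- The uniform measure on the sphere is invariant under linear isometries, because Lebesgue
measure is and cones over subsets of the sphere are mapped to cones. -/
lemma measurePreserving_spinMap {n : ℕ}
    (e : EuclideanSpace ℝ (Fin n) ≃ₗᵢ[ℝ] EuclideanSpace ℝ (Fin n)) :
    MeasurePreserving (spinMap e) (spinMeasure n) (spinMeasure n) := by
  have hm : Measurable (spinMap e) := (continuous_spinMap e).measurable
  refine MeasurePreserving.smul_measure ⟨hm, ?_⟩ _
  ext A hA
  rw [Measure.map_apply hm hA, Measure.toSphere_apply' _ (hm hA), Measure.toSphere_apply' _ hA]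
  congr 1
  rw [← e.measurePreserving.measure_preimage_equiv (f := e.toMeasurableEquiv)
    (Ioo (0 : ℝ) 1 • Subtype.val '' A)]
  congr 1
  ext x
  change _ ↔ e x ∈ (Ioo (0 : ℝ) 1 • Subtype.val '' A : Set (EuclideanSpace ℝ (Fin n)))
  constructor
  · rintro ⟨r, hr, _, ⟨s, hs, rfl⟩, rfl⟩
    exact ⟨r, hr, _, ⟨_, hs, rfl⟩, by simp [spinMap]⟩
  · rintro ⟨r, hr, _, ⟨s, hs, rfl⟩, h⟩
    refine ⟨r, hr, _, ⟨spinMap e.symm s, by simpa [spinMap] using hs, rfl⟩, ?_⟩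
    apply e.injective
    simpa [spinMap] using h

lemma Continuous.integrable_of_compactSpace {X : Type*} [TopologicalSpace X] [CompactSpace X]
    [MeasurableSpace X] [OpensMeasurableSpace X] {μ : Measure X} [IsFiniteMeasure μ] {f : X → ℝ}
    (hf : Continuous f) : Integrable f μ :=
  hf.integrable_of_hasCompactSupport (HasCompactSupport.of_compactSpace f)

lemma continuous_map_inner_prod {n : ℕ} {ι : Type*} (v : ι → EuclideanSpace ℝ (Fin n))
    (C : Multiset ι) :
    Continuous fun s : Spin n =>
      (C.map fun c => inner ℝ (s : EuclideanSpace ℝ (Fin n)) (v c)).prod :=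
  continuous_multiset_prod _ fun _ _ => by fun_prop


lemma HasDerivAt.multiset_prod {ι : Type*} [DecidableEq ι] {C : Multiset ι} {f : ι → ℝ → ℝ}
    {f' : ι → ℝ} {t : ℝ} (h : ∀ c ∈ C, HasDerivAt (f c) (f' c) t) :
    HasDerivAt (fun u => (C.map fun c => f c u).prod)
      (C.map fun c => f' c * ((C.erase c).map fun d => f d t).prod).sum t := by
  refine (HasFDerivAt.multiset_prod fun c hc => (h c hc).hasFDerivAt).hasDerivAt.congr_deriv ?_
  have := map_multiset_sum (ContinuousLinearMap.apply ℝ ℝ (1 : ℝ)) (C.map fun i =>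
    ((C.erase i).map fun d => f d t).prod • ContinuousLinearMap.toSpanSingleton ℝ (f' i))
  simp only [ContinuousLinearMap.apply_apply, Multiset.map_map, Function.comp_def] at this
  rw [this]
  simp [mul_comm]

/-- The derivative of `∏ c, ⟪s, v c⟫` along an infinitesimal rotation `S` has integral zero:
differentiate the rotation invariance of the integral along the one-parameter group
`exp (t • S)`. -/
lemma integral_sum_inner_skew_mul_prod {n : ℕ} (hn : 2 ≤ n) {ι : Type*} [DecidableEq ι]
    (v : ι → EuclideanSpace ℝ (Fin n)) (C : Multiset ι)
    {S : EuclideanSpace ℝ (Fin n) →L[ℝ] EuclideanSpace ℝ (Fin n)} (hS : S ∈ skewAdjoint _) :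
    ∫ s : Spin n, (C.map fun c => inner ℝ (S s) (v c) *
      ((C.erase c).map fun d => inner ℝ (s : EuclideanSpace ℝ (Fin n)) (v d)).prod).sum
        ∂spinMeasure n = 0 := by
  have := isProbabilityMeasure_spinMeasure hn
  set D : Spin n → ℝ := fun s => (C.map fun c => inner ℝ (S s) (v c) *
      ((C.erase c).map fun d => inner ℝ (s : EuclideanSpace ℝ (Fin n)) (v d)).prod).sum with hD
  have hDc : Continuous D := by
    refine continuous_multiset_sum _ fun c _ => ?_
    exact Continuous.mul (by fun_prop) (continuous_map_inner_prod v _)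
  obtain ⟨K, hK⟩ := isCompact_univ.exists_bound_of_continuousOn hDc.continuousOn
  let _ : NormedAlgebra ℚ (EuclideanSpace ℝ (Fin n) →L[ℝ] EuclideanSpace ℝ (Fin n)) :=
    NormedAlgebra.restrictScalars ℚ ℝ _
  have hU : ∀ t : ℝ, NormedSpace.exp (t • S) ∈ unitary _ := fun t =>
    NormedSpace.exp_mem_unitary_of_mem_skewAdjoint (skewAdjoint.smul_mem t hS)
  let R : ℝ → Spin n → Spin n := fun t => spinMap (Unitary.linearIsometryEquiv ⟨_, hU t⟩)
  have hR : ∀ t s, ((R t s : Spin n) : EuclideanSpace ℝ (Fin n)) = NormedSpace.exp (t • S) s :=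
    fun t s => rfl
  let P : Spin n → ℝ := fun s =>
    (C.map fun c => inner ℝ (s : EuclideanSpace ℝ (Fin n)) (v c)).prod
  have hP : Continuous P := continuous_map_inner_prod v C
  have hRc : ∀ t, Continuous (R t) := fun t => continuous_spinMap _
  have hinv : ∀ (t : ℝ) (F : Spin n → ℝ), Continuous F →
      ∫ s, F (R t s) ∂spinMeasure n = ∫ s, F s ∂spinMeasure n := fun t F hF => by
    have := measurePreserving_spinMap (Unitary.linearIsometryEquiv ⟨_, hU t⟩)
    rw [← this.map_eq, integral_map this.measurable.aemeasurable hF.aestronglyMeasurable,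
      this.map_eq]
  have hder : ∀ (s : Spin n) (t : ℝ), HasDerivAt (fun t => P (R t s)) (D (R t s)) t := by
    intro s t
    refine HasDerivAt.multiset_prod fun c _ => ?_
    simp only [hR]
    have h1 := (hasDerivAt_exp_smul_const' (𝕂 := ℝ) S t).clm_apply
      (hasDerivAt_const t (s : EuclideanSpace ℝ (Fin n)))
    simpa using h1.inner ℝ (hasDerivAt_const t (v c))
  have key := (hasDerivAt_integral_of_dominated_loc_of_deriv_le (μ := spinMeasure n)
    (F := fun t s => P (R t s)) (F' := fun t s => D (R t s)) (x₀ := (0 : ℝ)) (s := univ)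
    (bound := fun _ => K) Filter.univ_mem
    (Filter.Eventually.of_forall fun t => (hP.comp (hRc t)).aestronglyMeasurable)
    (hP.comp (hRc 0)).integrable_of_compactSpace
    (hDc.comp (hRc 0)).aestronglyMeasurable
    (Filter.Eventually.of_forall fun s t _ => hK _ (mem_univ _))
    (integrable_const K)
    (Filter.Eventually.of_forall fun s t _ => hder s t)).2
  simp only [hinv _ P hP, hinv _ D hDc] at key
  exact key.unique (hasDerivAt_const _ _)

lemma integral_multiset_sum_map {X ι : Type*} [MeasurableSpace X] {μ : Measure X} (C : Multiset ι)
    {F : ι → X → ℝ} (hF : ∀ c, Integrable (F c) μ) :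
    ∫ x, (C.map fun c => F c x).sum ∂μ = (C.map fun c => ∫ x, F c x ∂μ).sum := by
  have : Integrable (fun x => (C.map fun c => F c x).sum) μ ∧
      ∫ x, (C.map fun c => F c x).sum ∂μ = (C.map fun c => ∫ x, F c x ∂μ).sum := by
    induction C using Multiset.induction with
    | empty => simp
    | cons c C ih =>
      simp only [Multiset.map_cons, Multiset.sum_cons]
      exact ⟨(hF c).add ih.1, by rw [integral_add (hF c) ih.1, ih.2]⟩
  exact this.2

/-- Spherical integration by parts, for products of linear functions. It follows by adding up
over an orthonormal basis `e` the invariance under the infinitesimal rotation of the plane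
spanned by `e i` and `w`, applied to the function `⟪s, e i⟫ * ∏ c, ⟪s, v c⟫`. -/
lemma integral_inner_mul_prod {n : ℕ} (hn : 2 ≤ n) {ι : Type*} [DecidableEq ι]
    (v : ι → EuclideanSpace ℝ (Fin n)) (C : Multiset ι) (w : EuclideanSpace ℝ (Fin n)) :
    ((n : ℝ) - 1 + C.card) * ∫ s : Spin n, inner ℝ (s : EuclideanSpace ℝ (Fin n)) w *
        (C.map fun c => inner ℝ (s : EuclideanSpace ℝ (Fin n)) (v c)).prod ∂spinMeasure n =
      (C.map fun c => inner ℝ w (v c) * ∫ s : Spin n, ((C.erase c).map fun d =>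
        inner ℝ (s : EuclideanSpace ℝ (Fin n)) (v d)).prod ∂spinMeasure n).sum := by
  have := isProbabilityMeasure_spinMeasure hn
  let e := EuclideanSpace.basisFun (Fin n) ℝ
  let S : Fin n → EuclideanSpace ℝ (Fin n) →L[ℝ] EuclideanSpace ℝ (Fin n) := fun i =>
    InnerProductSpace.rankOne ℝ (e i) w - InnerProductSpace.rankOne ℝ w (e i)
  have hS : ∀ i, S i ∈ skewAdjoint _ := fun i => by
    simp [S, skewAdjoint.mem_iff, ContinuousLinearMap.star_eq_adjoint]
  -- The index `none` stands for the additional factor `⟪s, e i⟫`.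
  let v' : Fin n → Option ι → EuclideanSpace ℝ (Fin n) := fun i c => c.elim (e i) v
  have h0 := fun i => integral_sum_inner_skew_mul_prod hn (v' i) (none ::ₘ C.map some) (hS i)
  let Q : Multiset ι → Spin n → ℝ := fun C s =>
    (C.map fun c => inner ℝ (s : EuclideanSpace ℝ (Fin n)) (v c)).prod
  have hQ : ∀ C, Continuous (Q C) := continuous_map_inner_prod v
  let D : Fin n → Spin n → ℝ := fun i s => inner ℝ (S i s) (e i) * Q C s +
    (C.map fun c => inner ℝ (S i s) (v c) *
      (inner ℝ (s : EuclideanSpace ℝ (Fin n)) (e i) * Q (C.erase c) s)).sum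
  have hDc : ∀ i, Continuous (D i) := fun i => by
    refine Continuous.add (Continuous.mul (by fun_prop) (hQ _)) ?_
    refine continuous_multiset_sum _ fun c _ => ?_
    exact Continuous.mul (by fun_prop) (Continuous.mul (by fun_prop) (hQ _))
  have hD : ∀ i, ∫ s, D i s ∂spinMeasure n = 0 := fun i => by
    rw [← h0 i]
    refine integral_congr_ae (Filter.Eventually.of_forall fun s => ?_)
    simp only [D, Multiset.map_cons, Multiset.sum_cons, Multiset.erase_cons_head, Multiset.map_map,
      Function.comp_def]
    congr 2
    refine Multiset.map_congr rfl fun c _ => ?_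
    rw [Multiset.erase_cons_tail _ (by simp), ← Multiset.map_erase _ (Option.some_injective _)]
    simp [v', Q, Function.comp_def]
  have hsum : ∀ s : Spin n, ∑ i, D i s =
      ((n : ℝ) - 1 + C.card) * (inner ℝ (s : EuclideanSpace ℝ (Fin n)) w * Q C s) -
        (C.map fun c => inner ℝ w (v c) * Q (C.erase c) s).sum := by
    intro s
    have hs : inner ℝ (s : EuclideanSpace ℝ (Fin n)) (s : EuclideanSpace ℝ (Fin n)) = (1 : ℝ) := by
      simp
    have h1 : ∑ i, inner ℝ (S i s) (e i) =
        ((n : ℝ) - 1) * inner ℝ (s : EuclideanSpace ℝ (Fin n)) w := by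
      have := e.sum_inner_mul_inner (s : EuclideanSpace ℝ (Fin n)) w
      simp only [S, sub_apply, InnerProductSpace.rankOne_apply, inner_sub_left,
        real_inner_smul_left, Finset.sum_sub_distrib]
      simp only [real_inner_comm, real_inner_self_eq_norm_sq, e.norm_eq_one] at this ⊢
      rw [this]
      simp
      ring
    have h2 : ∀ x, ∑ i, inner ℝ (S i s) x * inner ℝ (s : EuclideanSpace ℝ (Fin n)) (e i) =
        inner ℝ (s : EuclideanSpace ℝ (Fin n)) w * inner ℝ (s : EuclideanSpace ℝ (Fin n)) x
          - inner ℝ w x := by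
      intro x
      have a1 := e.sum_inner_mul_inner (s : EuclideanSpace ℝ (Fin n)) x
      have a2 := e.sum_inner_mul_inner (s : EuclideanSpace ℝ (Fin n)) s
      rw [hs] at a2
      rw [← a1, Finset.mul_sum]
      have a3 : inner ℝ w x = ∑ i, inner ℝ (s : EuclideanSpace ℝ (Fin n)) (e i) *
          inner ℝ (e i) (s : EuclideanSpace ℝ (Fin n)) * inner ℝ w x := by
        rw [← Finset.sum_mul, a2, one_mul]
      rw [a3, ← Finset.sum_sub_distrib]
      refine Finset.sum_congr rfl fun i _ => ?_
      simp only [S, sub_apply, InnerProductSpace.rankOne_apply, inner_sub_left,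
        real_inner_smul_left]
      simp only [real_inner_comm]
      ring
    have h3 : ∀ c ∈ C, inner ℝ (s : EuclideanSpace ℝ (Fin n)) (v c) * Q (C.erase c) s = Q C s :=
      fun c hc => Multiset.prod_map_erase
        (f := fun c => inner ℝ (s : EuclideanSpace ℝ (Fin n)) (v c)) hc
    have h4 : ∑ i, (C.map fun c => inner ℝ (S i s) (v c) *
        (inner ℝ (s : EuclideanSpace ℝ (Fin n)) (e i) * Q (C.erase c) s)).sum =
        (C.map fun c => inner ℝ (s : EuclideanSpace ℝ (Fin n)) w * Q C s -
          inner ℝ w (v c) * Q (C.erase c) s).sum := by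
      rw [Finset.sum_eq_multiset_sum, Multiset.sum_map_sum_map]
      refine congrArg _ (Multiset.map_congr rfl fun c hc => ?_)
      rw [← Finset.sum_eq_multiset_sum]
      calc _ = (∑ i, inner ℝ (S i s) (v c) * inner ℝ (s : EuclideanSpace ℝ (Fin n)) (e i)) *
            Q (C.erase c) s := by
            rw [Finset.sum_mul]
            exact Finset.sum_congr rfl fun i _ => by ring
        _ = _ := by rw [h2, ← h3 c hc]; ring
    simp only [D, Finset.sum_add_distrib, ← Finset.sum_mul, h1, h4, Multiset.sum_map_sub,
      Multiset.map_const', Multiset.sum_replicate, nsmul_eq_mul]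
    ring
  have hint : ∫ s, ∑ i, D i s ∂spinMeasure n = 0 := by
    rw [integral_finsetSum _ fun i _ => (hDc i).integrable_of_compactSpace]
    exact Finset.sum_eq_zero fun i _ => hD i
  simp only [hsum] at hint
  rw [integral_sub, integral_const_mul, integral_multiset_sum_map, sub_eq_zero] at hint
  · simpa only [integral_const_mul] using hint
  · exact fun c => ((hQ _).const_mul _).integrable_of_compactSpace
  · exact Continuous.integrable_of_compactSpace
      (Continuous.const_mul (Continuous.mul (by fun_prop) (hQ _)) _)
  · exact Continuous.integrable_of_compactSpace
      (continuous_multiset_sum _ fun c _ => (hQ _).const_mul _)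

/-! ### Positivity in coordinates -/

/-- The convex cone and semiring of functions of `N` spins generated by the inner products
`⟪σ i, σ j⟫`. -/
noncomputable def innerAlgebra (N n : ℕ) : Subalgebra ℝ≥0 ((Fin N → Spin n) → ℝ) :=
  Algebra.adjoin ℝ≥0 (range fun (p : Fin N × Fin N) (σ : Fin N → Spin n) =>
    inner ℝ (σ p.1 : EuclideanSpace ℝ (Fin n)) (σ p.2 : EuclideanSpace ℝ (Fin n)))

/-- The convex cone and semiring of functions of `N` spins generated by the coordinates of the
spins in an orthonormal basis `b`. -/
noncomputable def coordAlgebra (N : ℕ) {n : ℕ}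
    (b : OrthonormalBasis (Fin n) ℝ (EuclideanSpace ℝ (Fin n))) :
    Subalgebra ℝ≥0 ((Fin N → Spin n) → ℝ) :=
  Algebra.adjoin ℝ≥0 (range fun (p : Fin N × Fin n) (σ : Fin N → Spin n) =>
    inner ℝ (b p.2) (σ p.1 : EuclideanSpace ℝ (Fin n)))

lemma inner_mem_innerAlgebra {N n : ℕ} (i j : Fin N) :
    (fun σ : Fin N → Spin n =>
      inner ℝ (σ i : EuclideanSpace ℝ (Fin n)) (σ j : EuclideanSpace ℝ (Fin n))) ∈
      innerAlgebra N n :=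
  Algebra.subset_adjoin ⟨(i, j), rfl⟩

lemma coord_mem_coordAlgebra {N n : ℕ}
    (b : OrthonormalBasis (Fin n) ℝ (EuclideanSpace ℝ (Fin n))) (k : Fin N) (c : Fin n) :
    (fun σ : Fin N → Spin n => inner ℝ (b c) (σ k : EuclideanSpace ℝ (Fin n))) ∈
      coordAlgebra N b :=
  Algebra.subset_adjoin ⟨(k, c), rfl⟩

lemma continuous_of_mem_innerAlgebra {N n : ℕ} {f : (Fin N → Spin n) → ℝ}
    (hf : f ∈ innerAlgebra N n) : Continuous f := by
  induction hf using Algebra.adjoin_induction with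
  | mem f hf =>
    obtain ⟨p, rfl⟩ := hf
    fun_prop
  | algebraMap r => exact continuous_const
  | add f g _ _ hf hg => exact hf.add hg
  | mul f g _ _ hf hg => exact hf.mul hg

/-- If some exponent is odd, the reflection in the corresponding coordinate hyperplane shows that
the moment vanishes; otherwise the integrand is a product of even powers. -/
lemma integral_prod_coord_pow_nonneg {n : ℕ}
    (b : OrthonormalBasis (Fin n) ℝ (EuclideanSpace ℝ (Fin n))) (m : Fin n → ℕ) :
    0 ≤ ∫ s : Spin n, ∏ c, inner ℝ (b c) (s : EuclideanSpace ℝ (Fin n)) ^ m c ∂spinMeasure n := by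
  by_cases h : ∀ c, Even (m c)
  · exact integral_nonneg fun s => Finset.prod_nonneg fun c _ => (h c).pow_nonneg _
  · push Not at h
    obtain ⟨c₀, hc₀⟩ := h
    rw [Nat.not_even_iff_odd] at hc₀
    -- The reflection that changes the sign of the coordinate `c₀` only.
    let e := (ℝ ∙ b c₀)ᗮ.reflection
    have he : ∀ (c : Fin n) (s : Spin n), inner ℝ (b c) (spinMap e s : EuclideanSpace ℝ (Fin n)) =
        (if c = c₀ then -1 else 1) * inner ℝ (b c) (s : EuclideanSpace ℝ (Fin n)) := by
      intro c s
      change inner ℝ (b c) (e s) = _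
      have : inner ℝ (b c) (e s) = inner ℝ (e (b c)) (s : EuclideanSpace ℝ (Fin n)) := by
        rw [← e.inner_map_map (b c) (e s)]
        simp [e]
      rw [this]
      split_ifs with hc
      · subst hc
        rw [Submodule.reflection_orthogonalComplement_singleton_eq_neg]
        simp
      · rw [Submodule.reflection_mem_subspace_eq_self]
        · simp
        · rw [Submodule.mem_orthogonal_singleton_iff_inner_right]
          simp [b.inner_eq_ite, Ne.symm hc]
    have hc : Continuous fun s : Spin n =>
        ∏ c, inner ℝ (b c) (s : EuclideanSpace ℝ (Fin n)) ^ m c := by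
      fun_prop
    have hmp := measurePreserving_spinMap e
    have h1 : ∫ s : Spin n, ∏ c, inner ℝ (b c) (spinMap e s : EuclideanSpace ℝ (Fin n)) ^ m c
        ∂spinMeasure n =
        ∫ s : Spin n, ∏ c, inner ℝ (b c) (s : EuclideanSpace ℝ (Fin n)) ^ m c ∂spinMeasure n := by
      conv_rhs => rw [← hmp.map_eq]
      rw [integral_map hmp.measurable.aemeasurable hc.aestronglyMeasurable]
    have h2 : ∀ s : Spin n, ∏ c, inner ℝ (b c) (spinMap e s : EuclideanSpace ℝ (Fin n)) ^ m c =
        -∏ c, inner ℝ (b c) (s : EuclideanSpace ℝ (Fin n)) ^ m c := by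
      intro s
      simp only [he, mul_pow, Finset.prod_mul_distrib, ite_pow, one_pow, Finset.prod_ite_eq',
        Finset.mem_univ, if_true, hc₀.neg_one_pow, neg_one_mul]
    simp only [h2, integral_neg] at h1
    linarith

/-- Expanded in coordinates, the mean of a monomial factorizes over the spins. -/
lemma spinExpectation_nonneg_of_mem_coordAlgebra {N n : ℕ} (hn : 2 ≤ n)
    {b : OrthonormalBasis (Fin n) ℝ (EuclideanSpace ℝ (Fin n))} {f : (Fin N → Spin n) → ℝ}
    (hf : f ∈ coordAlgebra N b) : 0 ≤ spinExpectation N n f := by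
  have := isProbabilityMeasure_spinMeasure hn
  rw [coordAlgebra, ← Subalgebra.mem_toSubmodule, Algebra.adjoin_eq_span] at hf
  suffices Continuous f ∧ 0 ≤ spinExpectation N n f from this.2
  induction hf using Submodule.span_induction with
  | mem f hf =>
    have : ∃ m : Fin N → Fin n → ℕ, f = fun σ =>
        ∏ k, ∏ c, inner ℝ (b c) (σ k : EuclideanSpace ℝ (Fin n)) ^ m k c := by
      induction hf using Submonoid.closure_induction with
      | mem f hf =>
        obtain ⟨⟨k₀, c₀⟩, rfl⟩ := hf
        refine ⟨fun k c => if c = c₀ then if k = k₀ then 1 else 0 else 0, funext fun σ => ?_⟩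
        simp [pow_ite, Finset.prod_ite_eq']
      | one => exact ⟨0, by ext; simp⟩
      | mul f g _ _ hf hg =>
        obtain ⟨m, rfl⟩ := hf
        obtain ⟨m', rfl⟩ := hg
        exact ⟨m + m', by ext; simp [pow_add, Finset.prod_mul_distrib]⟩
    obtain ⟨m, rfl⟩ := this
    refine ⟨by fun_prop, ?_⟩
    rw [spinExpectation, integral_fintype_prod_eq_prod (μ := fun _ : Fin N => spinMeasure n)
      fun k (s : Spin n) => ∏ c, inner ℝ (b c) (s : EuclideanSpace ℝ (Fin n)) ^ m k c]
    exact Finset.prod_nonneg fun k _ => integral_prod_coord_pow_nonneg b (m k)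
  | zero => exact ⟨continuous_const, by simp [spinExpectation]⟩
  | add f g _ _ hf hg =>
    refine ⟨hf.1.add hg.1, ?_⟩
    have := integral_add (μ := Measure.pi fun _ : Fin N => spinMeasure n)
      hf.1.integrable_of_compactSpace hg.1.integrable_of_compactSpace
    exact (add_nonneg hf.2 hg.2).trans_eq this.symm
  | smul r f _ hf =>
    refine ⟨hf.1.const_smul r, ?_⟩
    have := integral_const_mul (μ := Measure.pi fun _ : Fin N => spinMeasure n) (r : ℝ) f
    exact (mul_nonneg r.2 hf.2).trans_eq this.symm

lemma innerAlgebra_le_coordAlgebra {N n : ℕ}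
    (b : OrthonormalBasis (Fin n) ℝ (EuclideanSpace ℝ (Fin n))) :
    innerAlgebra N n ≤ coordAlgebra N b := by
  refine Algebra.adjoin_le ?_
  rintro _ ⟨⟨i, j⟩, rfl⟩
  have : (fun σ : Fin N → Spin n =>
      inner ℝ (σ i : EuclideanSpace ℝ (Fin n)) (σ j : EuclideanSpace ℝ (Fin n))) =
      ∑ c, (fun σ : Fin N → Spin n => inner ℝ (b c) (σ i : EuclideanSpace ℝ (Fin n))) *
        fun σ => inner ℝ (b c) (σ j : EuclideanSpace ℝ (Fin n)) := by
    ext σ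
    rw [← b.sum_inner_mul_inner]
    simp [Finset.sum_apply, real_inner_comm]
  refine (congrArg (· ∈ coordAlgebra N b) this).mpr ?_
  exact sum_mem fun c _ => mul_mem (coord_mem_coordAlgebra b i c) (coord_mem_coordAlgebra b j c)

/-- Removing one coordinate from an inner product leaves a sum of products of coordinates. -/
lemma inner_sub_coord_mul_coord_mem_coordAlgebra {N n : ℕ}
    (b : OrthonormalBasis (Fin n) ℝ (EuclideanSpace ℝ (Fin n))) (i j : Fin N) (c₀ : Fin n) :
    (fun σ : Fin N → Spin n =>
      inner ℝ (σ i : EuclideanSpace ℝ (Fin n)) (σ j : EuclideanSpace ℝ (Fin n)) -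
        inner ℝ (b c₀) (σ i : EuclideanSpace ℝ (Fin n)) *
          inner ℝ (b c₀) (σ j : EuclideanSpace ℝ (Fin n))) ∈ coordAlgebra N b := by
  have : (fun σ : Fin N → Spin n =>
      inner ℝ (σ i : EuclideanSpace ℝ (Fin n)) (σ j : EuclideanSpace ℝ (Fin n)) -
        inner ℝ (b c₀) (σ i : EuclideanSpace ℝ (Fin n)) *
          inner ℝ (b c₀) (σ j : EuclideanSpace ℝ (Fin n))) =
      ∑ c ∈ Finset.univ.erase c₀,
        (fun σ : Fin N → Spin n => inner ℝ (b c) (σ i : EuclideanSpace ℝ (Fin n))) *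
        fun σ => inner ℝ (b c) (σ j : EuclideanSpace ℝ (Fin n)) := by
    ext σ
    rw [← b.sum_inner_mul_inner, ← Finset.add_sum_erase _ _ (Finset.mem_univ c₀)]
    simp [Finset.sum_apply, real_inner_comm]
  rw [this]
  exact sum_mem fun c _ => mul_mem (coord_mem_coordAlgebra b i c) (coord_mem_coordAlgebra b j c)

lemma exists_orthonormalBasis_apply_zero {n : ℕ} [NeZero n] (s : Spin n) :
    ∃ b : OrthonormalBasis (Fin n) ℝ (EuclideanSpace ℝ (Fin n)), b 0 = s := by
  obtain ⟨b, hb⟩ := Orthonormal.exists_orthonormalBasis_extension_of_card_eq (𝕜 := ℝ)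
    (E := EuclideanSpace ℝ (Fin n)) (ι := Fin n) (by simp)
    (v := fun _ => (s : EuclideanSpace ℝ (Fin n)))
    (s := {0}) (by
      refine ⟨fun i => by simp, fun i j hij => (hij (Subsingleton.elim i j)).elim⟩)
  exact ⟨b, hb 0 rfl⟩

/-! ### Covariance under a single spin -/

/-- The product of the inner products of a spin `s` with the spins `τ c`, `c ∈ C`. -/
noncomputable def starProd {N n : ℕ} (C : Multiset (Fin N)) (τ : Fin N → Spin n)
    (s : Spin n) : ℝ :=
  (C.map fun c => inner ℝ (s : EuclideanSpace ℝ (Fin n)) (τ c : EuclideanSpace ℝ (Fin n))).prod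

/-- The mean of `starProd C τ s` over the spin `s`. -/
noncomputable def starMean {N n : ℕ} (C : Multiset (Fin N)) (τ : Fin N → Spin n) : ℝ :=
  ∫ s, starProd C τ s ∂spinMeasure n

lemma starProd_cons {N n : ℕ} (c : Fin N) (C : Multiset (Fin N)) (τ : Fin N → Spin n)
    (s : Spin n) : starProd (c ::ₘ C) τ s =
      inner ℝ (s : EuclideanSpace ℝ (Fin n)) (τ c : EuclideanSpace ℝ (Fin n)) * starProd C τ s := by
  simp [starProd]

lemma starProd_add {N n : ℕ} (A B : Multiset (Fin N)) (τ : Fin N → Spin n) (s : Spin n) :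
    starProd (A + B) τ s = starProd A τ s * starProd B τ s := by
  simp [starProd]

lemma continuous_starProd {N n : ℕ} (C : Multiset (Fin N)) :
    Continuous fun p : (Fin N → Spin n) × Spin n => starProd C p.1 p.2 :=
  continuous_multiset_prod _ fun _ _ => by fun_prop

lemma starMean_zero {N n : ℕ} (hn : 2 ≤ n) (τ : Fin N → Spin n) : starMean 0 τ = 1 := by
  have := isProbabilityMeasure_spinMeasure hn
  simp [starMean, starProd]

/-- The spherical analogue of Wick's recursion: pair the factor `c` with each other factor. -/
lemma starMean_cons {N n : ℕ} (hn : 2 ≤ n) (c : Fin N) (C : Multiset (Fin N))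
    (τ : Fin N → Spin n) : ((n : ℝ) - 1 + C.card) * starMean (c ::ₘ C) τ =
      (C.map fun d => inner ℝ (τ c : EuclideanSpace ℝ (Fin n)) (τ d : EuclideanSpace ℝ (Fin n)) *
        starMean (C.erase d) τ).sum := by
  simp only [starMean, starProd_cons]
  exact integral_inner_mul_prod hn (fun c => (τ c : EuclideanSpace ℝ (Fin n))) C _

lemma starMean_mem_innerAlgebra {N n : ℕ} (hn : 2 ≤ n) (C : Multiset (Fin N)) :
    (starMean C : (Fin N → Spin n) → ℝ) ∈ innerAlgebra N n := by
  induction C using Multiset.strongInductionOn with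
  | ih C ih =>
    induction C using Multiset.induction with
    | empty =>
      rw [show (starMean 0 : (Fin N → Spin n) → ℝ) = 1 from funext (starMean_zero hn)]
      exact one_mem _
    | cons c C _ =>
      have hpos : 0 < (n : ℝ) - 1 + C.card := by
        have : (2 : ℝ) ≤ n := by exact_mod_cast hn
        have : (0 : ℝ) ≤ C.card := Nat.cast_nonneg _
        linarith
      have h : (starMean (c ::ₘ C) : (Fin N → Spin n) → ℝ) =
          (⟨((n : ℝ) - 1 + C.card)⁻¹, (inv_pos.2 hpos).le⟩ : ℝ≥0) •
            (C.map fun d => (fun τ : Fin N → Spin n =>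
              inner ℝ (τ c : EuclideanSpace ℝ (Fin n)) (τ d : EuclideanSpace ℝ (Fin n))) *
                starMean (C.erase d)).sum := by
        ext τ
        have := map_multiset_sum (Pi.evalAddMonoidHom (fun _ => ℝ) τ)
          (C.map fun d => (fun τ : Fin N → Spin n =>
              inner ℝ (τ c : EuclideanSpace ℝ (Fin n)) (τ d : EuclideanSpace ℝ (Fin n))) *
                starMean (C.erase d))
        simp only [Pi.evalAddMonoidHom_apply, Multiset.map_map, Function.comp_def, Pi.mul_apply]
          at this
        rw [Pi.smul_apply, this, ← starMean_cons hn]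
        simp [hpos.ne']
      rw [h]
      refine Subalgebra.smul_mem _ (multiset_sum_mem _ fun f hf => ?_) _
      obtain ⟨d, hd, rfl⟩ := Multiset.mem_map.1 hf
      exact mul_mem (inner_mem_innerAlgebra c d) (ih _
        ((Multiset.erase_le d C).trans_lt (Multiset.lt_cons_self C c)))

/-- The first factor is the mean over `s` of
`(⟪τ b, τ a⟫ - ⟪s, τ b⟫ ⟪s, τ a⟫) * starProd C τ s`. For fixed `s`, the difference is the inner
product of the components of `τ b` and `τ a` orthogonal to `s`, so the whole integrand has
nonnegative coefficients in the coordinates with respect to a basis containing `s`. -/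
lemma integral_inner_mul_starMean_sub_nonneg {N n : ℕ} (hn : 2 ≤ n) (a b : Fin N)
    (C : Multiset (Fin N)) {H : (Fin N → Spin n) → ℝ} (hH : H ∈ innerAlgebra N n) :
    0 ≤ spinExpectation N n fun τ =>
      (inner ℝ (τ b : EuclideanSpace ℝ (Fin n)) (τ a : EuclideanSpace ℝ (Fin n)) * starMean C τ -
        starMean (b ::ₘ a ::ₘ C) τ) * H τ := by
  have := isProbabilityMeasure_spinMeasure hn
  have : NeZero n := ⟨by omega⟩
  let K : (Fin N → Spin n) → Spin n → ℝ := fun τ s =>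
    (inner ℝ (τ b : EuclideanSpace ℝ (Fin n)) (τ a : EuclideanSpace ℝ (Fin n)) -
      inner ℝ (s : EuclideanSpace ℝ (Fin n)) (τ b : EuclideanSpace ℝ (Fin n)) *
      inner ℝ (s : EuclideanSpace ℝ (Fin n)) (τ a : EuclideanSpace ℝ (Fin n))) *
      starProd C τ s * H τ
  have hK : Continuous fun p : (Fin N → Spin n) × Spin n => K p.1 p.2 := by
    have h1 := continuous_starProd (n := n) C
    have h2 := continuous_of_mem_innerAlgebra hH
    fun_prop
  have hint : ∀ C' : Multiset (Fin N), ∀ τ : Fin N → Spin n,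
      Integrable (starProd C' τ) (spinMeasure n) := fun C' τ =>
    ((continuous_starProd C').comp (Continuous.prodMk_right τ)).integrable_of_compactSpace
  have h : ∀ τ : Fin N → Spin n,
      (inner ℝ (τ b : EuclideanSpace ℝ (Fin n)) (τ a : EuclideanSpace ℝ (Fin n)) * starMean C τ -
        starMean (b ::ₘ a ::ₘ C) τ) * H τ = ∫ s, K τ s ∂spinMeasure n := by
    intro τ
    rw [starMean, starMean, ← integral_const_mul,
      ← integral_sub ((hint _ _).const_mul _) (hint _ _), ← integral_mul_const]
    refine integral_congr_ae (Filter.Eventually.of_forall fun s => ?_)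
    simp only [starProd_cons, K]
    ring
  simp only [spinExpectation, h]
  rw [integral_integral_swap (f := K) hK.integrable_of_compactSpace]
  refine integral_nonneg fun s => ?_
  obtain ⟨e, he⟩ := exists_orthonormalBasis_apply_zero s
  refine spinExpectation_nonneg_of_mem_coordAlgebra hn (b := e) ?_
  refine mul_mem (mul_mem ?_ ?_) (innerAlgebra_le_coordAlgebra e hH)
  · have := inner_sub_coord_mul_coord_mem_coordAlgebra e b a 0
    simpa only [he] using this
  · have h1 : (fun τ : Fin N → Spin n => starProd C τ s) = (C.map fun c => fun τ : Fin N → Spin n =>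
        inner ℝ (e 0) (τ c : EuclideanSpace ℝ (Fin n))).prod := by
      ext τ
      have := map_multiset_prod (Pi.evalMonoidHom (fun _ => ℝ) τ) (C.map fun c =>
        fun τ : Fin N → Spin n => inner ℝ (e 0) (τ c : EuclideanSpace ℝ (Fin n)))
      simp only [Pi.evalMonoidHom_apply, Multiset.map_map, Function.comp_def] at this
      rw [this, he, starProd]
    refine (congrArg (· ∈ coordAlgebra N e) h1).mpr (multiset_prod_mem _ fun f hf => ?_)
    obtain ⟨d, -, rfl⟩ := Multiset.mem_map.1 hf
    exact coord_mem_coordAlgebra e d 0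

/-- Correlation inequality for a single spin: replacing the joint mean over `s` of two products
by the product of their means decreases the expectation. -/
lemma spinExpectation_starMean_mul_starMean_le {N n : ℕ} (hn : 2 ≤ n) (A B : Multiset (Fin N))
    {H : (Fin N → Spin n) → ℝ} (hH : H ∈ innerAlgebra N n) :
    spinExpectation N n (fun τ => starMean A τ * starMean B τ * H τ) ≤
      spinExpectation N n fun τ => starMean (A + B) τ * H τ := by
  have := isProbabilityMeasure_spinMeasure hn
  induction B using Multiset.strongInductionOn generalizing H with
  | ih B ih =>
    induction B using Multiset.induction with
    | empty => simp [starMean_zero hn]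
    | cons b B _ =>
      have hpos : 0 < (n : ℝ) - 1 + B.card := by
        have : (2 : ℝ) ≤ n := by exact_mod_cast hn
        have : (0 : ℝ) ≤ B.card := Nat.cast_nonneg _
        linarith
      have hI : ∀ C : Multiset (Fin N), Continuous (starMean C : (Fin N → Spin n) → ℝ) :=
        fun C => continuous_of_mem_innerAlgebra (starMean_mem_innerAlgebra hn C)
      have hHc := continuous_of_mem_innerAlgebra hH
      have hint : ∀ {f : (Fin N → Spin n) → ℝ}, Continuous f →
        Integrable f (Measure.pi fun _ : Fin N => spinMeasure n) :=
          fun hf => hf.integrable_of_compactSpace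
      let ip : Fin N → (Fin N → Spin n) → ℝ := fun d τ =>
        inner ℝ (τ b : EuclideanSpace ℝ (Fin n)) (τ d : EuclideanSpace ℝ (Fin n))
      have hip : ∀ d, Continuous (ip d) := fun d => by fun_prop
      let X : Fin N → (Fin N → Spin n) → ℝ := fun a τ =>
        (ip a τ * starMean (A.erase a + B) τ - starMean (b ::ₘ a ::ₘ (A.erase a + B)) τ) * H τ
      let Y : Fin N → (Fin N → Spin n) → ℝ := fun d τ =>
        starMean (A + B.erase d) τ * (ip d τ * H τ)
      let Z : Fin N → (Fin N → Spin n) → ℝ := fun d τ =>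
        starMean A τ * starMean (B.erase d) τ * (ip d τ * H τ)
      have hX : ∀ a, Continuous (X a) := fun a =>
        (((hip a).mul (hI _)).sub (hI _)).mul hHc
      have hY : ∀ a, Continuous (Y a) := fun a => (hI _).mul ((hip a).mul hHc)
      have hZ : ∀ a, Continuous (Z a) := fun a => ((hI _).mul (hI _)).mul ((hip a).mul hHc)
      -- Wick's recursion in the factor `b`, with the terms pairing `b` to `A` compensated by the
      -- contribution of `A` to the prefactor.
      have key : ∀ τ : Fin N → Spin n,
          ((n : ℝ) - 1 + B.card) * (starMean (A + b ::ₘ B) τ * H τ) =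
            (A.map fun a => X a τ).sum + (B.map fun d => Y d τ).sum := by
        intro τ
        have h1 := starMean_cons hn b (A + B) τ
        have h2 : A.map (fun a => X a τ) = A.map fun a =>
            (ip a τ * starMean ((A + B).erase a) τ - starMean (b ::ₘ (A + B)) τ) * H τ := by
          refine Multiset.map_congr rfl fun a ha => ?_
          simp only [X]
          rw [← Multiset.cons_add a, Multiset.cons_erase ha, Multiset.erase_add_left_pos _ ha]
        have h3 : B.map (fun d => Y d τ) = B.map fun d =>
            ip d τ * starMean ((A + B).erase d) τ * H τ := by
          refine Multiset.map_congr rfl fun d hd => ?_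
          simp only [Y]
          rw [Multiset.erase_add_right_pos _ hd]
          ring
        rw [h2, h3, Multiset.sum_map_mul_right, Multiset.sum_map_mul_right, Multiset.sum_map_sub,
          ← add_mul, Multiset.map_const', Multiset.sum_replicate, nsmul_eq_mul]
        rw [Multiset.map_add, Multiset.sum_add, Multiset.card_add, Nat.cast_add] at h1
        rw [Multiset.add_cons]
        linear_combination H τ * h1
      have key' : ∀ τ : Fin N → Spin n,
          ((n : ℝ) - 1 + B.card) * (starMean A τ * starMean (b ::ₘ B) τ * H τ) =
            (B.map fun d => Z d τ).sum := by
        intro τ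
        have h1 := starMean_cons hn b B τ
        have h3 : B.map (fun d => Z d τ) = B.map fun d =>
            starMean A τ * H τ * (ip d τ * starMean (B.erase d) τ) :=
          Multiset.map_congr rfl fun d _ => by simp only [Z]; ring
        rw [h3, Multiset.sum_map_mul_left, ← h1]
        ring
      refine le_of_mul_le_mul_left ?_ hpos
      simp only [spinExpectation]
      rw [← integral_const_mul, ← integral_const_mul]
      simp only [key, key']
      rw [integral_add (hint (continuous_multiset_sum _ fun a _ => hX a))
        (hint (continuous_multiset_sum _ fun a _ => hY a)),
        integral_multiset_sum_map _ fun a => hint (hX a),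
        integral_multiset_sum_map _ fun a => hint (hY a),
        integral_multiset_sum_map _ fun a => hint (hZ a)]
      refine le_add_of_nonneg_of_le (Multiset.sum_nonneg fun x hx => ?_)
        (Multiset.sum_map_le_sum_map _ _ fun d _ => ?_)
      · obtain ⟨a, -, rfl⟩ := Multiset.mem_map.1 hx
        exact integral_inner_mul_starMean_sub_nonneg hn a b _ hH
      · exact ih _ ((Multiset.erase_le d B).trans_lt (Multiset.lt_cons_self B b))
          (mul_mem (inner_mem_innerAlgebra b d) hH)

/-! ### Integrating out the spins one at a time -/

/-- The mean of a function of `N + 1` spins over the spin with index `0`. -/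
noncomputable def headMean {N n : ℕ} (f : (Fin (N + 1) → Spin n) → ℝ) (τ : Fin N → Spin n) : ℝ :=
  ∫ s, f (Fin.cons s τ : Fin (N + 1) → Spin n) ∂spinMeasure n

lemma spinExpectation_headMean {N n : ℕ} (hn : 2 ≤ n) {f : (Fin (N + 1) → Spin n) → ℝ}
    (hf : Continuous f) : spinExpectation N n (headMean f) = spinExpectation (N + 1) n f := by
  have := isProbabilityMeasure_spinMeasure hn
  have hmp := (measurePreserving_piFinSuccAbove (fun _ : Fin (N + 1) => spinMeasure n) 0).symm
  rw [spinExpectation, spinExpectation, ← hmp.integral_comp', integral_prod_symm]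
  · refine integral_congr_ae (Filter.Eventually.of_forall fun τ => ?_)
    refine integral_congr_ae (Filter.Eventually.of_forall fun s => ?_)
    simp [MeasurableEquiv.piFinSuccAbove, Fin.consEquiv]
  · refine Continuous.integrable_of_compactSpace (hf.comp ?_)
    have : Continuous fun p : Spin n × (Fin N → Spin n) =>
        (Fin.cons p.1 p.2 : Fin (N + 1) → Spin n) := by fun_prop
    simpa [MeasurableEquiv.piFinSuccAbove, Fin.consEquiv] using this

/-- The functions `σ ↦ starProd C (Fin.tail σ) (σ 0) * F (Fin.tail σ)`, in which the dependence on
the spin with index `0` has been separated. -/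
def starFunctions (N n : ℕ) : Set ((Fin (N + 1) → Spin n) → ℝ) :=
  {f | ∃ (C : Multiset (Fin N)) (F : (Fin N → Spin n) → ℝ), F ∈ innerAlgebra N n ∧
    ∀ s τ, f (Fin.cons s τ : Fin (N + 1) → Spin n) = starProd C τ s * F τ}

lemma innerAlgebra_succ_le_span {N n : ℕ} {f : (Fin (N + 1) → Spin n) → ℝ}
    (hf : f ∈ innerAlgebra (N + 1) n) : f ∈ Submodule.span ℝ≥0 (starFunctions N n) := by
  rw [innerAlgebra, ← Subalgebra.mem_toSubmodule, Algebra.adjoin_eq_span] at hf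
  refine Submodule.span_mono (fun f hf => ?_) hf
  induction hf using Submonoid.closure_induction with
  | one => exact ⟨0, 1, one_mem _, fun s τ => by simp [starProd]⟩
  | mul f g _ _ hf hg =>
    obtain ⟨A, F, hF, hf⟩ := hf
    obtain ⟨B, G, hG, hg⟩ := hg
    refine ⟨A + B, F * G, mul_mem hF hG, fun s τ => ?_⟩
    simp only [Pi.mul_apply, hf, hg, starProd_add]
    ring
  | mem f hf =>
    obtain ⟨⟨i, j⟩, rfl⟩ := hf
    induction i using Fin.cases with
    | zero =>
      induction j using Fin.cases with
      | zero => exact ⟨0, 1, one_mem _, fun s τ => by simp [starProd]⟩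
      | succ j => exact ⟨{j}, 1, one_mem _, fun s τ => by simp [starProd]⟩
    | succ i =>
      induction j using Fin.cases with
      | zero => exact ⟨{i}, 1, one_mem _, fun s τ => by simp [starProd, real_inner_comm]⟩
      | succ j => exact ⟨0, _, inner_mem_innerAlgebra i j, fun s τ => by simp [starProd]⟩

lemma continuous_of_mem_starFunctions {N n : ℕ} {f : (Fin (N + 1) → Spin n) → ℝ}
    (hf : f ∈ starFunctions N n) : Continuous f := by
  obtain ⟨C, F, hF, hf⟩ := hf
  have : f = fun σ => starProd C (Fin.tail σ) (σ 0) * F (Fin.tail σ) :=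
    funext fun σ => by rw [← hf, Fin.cons_self_tail]
  rw [this]
  have h1 := continuous_starProd (n := n) C
  have h2 := continuous_of_mem_innerAlgebra hF
  have h3 : Continuous fun σ : Fin (N + 1) → Spin n => Fin.tail σ := by
    unfold Fin.tail; fun_prop
  exact (h1.comp (h3.prodMk (continuous_apply 0))).mul (h2.comp h3)

lemma headMean_add {N n : ℕ} (hn : 2 ≤ n) {f g : (Fin (N + 1) → Spin n) → ℝ}
    (hf : Continuous f) (hg : Continuous g) : headMean (f + g) = headMean f + headMean g := by
  have := isProbabilityMeasure_spinMeasure hn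
  ext τ
  have h : Continuous fun s : Spin n => (Fin.cons s τ : Fin (N + 1) → Spin n) := by fun_prop
  exact integral_add (hf.comp h).integrable_of_compactSpace (hg.comp h).integrable_of_compactSpace

lemma headMean_smul {N n : ℕ} (r : ℝ≥0) (f : (Fin (N + 1) → Spin n) → ℝ) :
    headMean (r • f) = r • headMean f :=
  funext fun _ => integral_const_mul (r : ℝ) _

lemma spinExpectation_add {N n : ℕ} (hn : 2 ≤ n) {f g : (Fin N → Spin n) → ℝ}
    (hf : Continuous f) (hg : Continuous g) :
    spinExpectation N n (f + g) = spinExpectation N n f + spinExpectation N n g := by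
  have := isProbabilityMeasure_spinMeasure hn
  exact integral_add hf.integrable_of_compactSpace hg.integrable_of_compactSpace

lemma spinExpectation_smul {N n : ℕ} (r : ℝ≥0) (f : (Fin N → Spin n) → ℝ) :
    spinExpectation N n (r • f) = r * spinExpectation N n f :=
  integral_const_mul (r : ℝ) _

lemma continuous_and_headMean_mem_innerAlgebra {N n : ℕ} (hn : 2 ≤ n)
    {f : (Fin (N + 1) → Spin n) → ℝ} (hf : f ∈ Submodule.span ℝ≥0 (starFunctions N n)) :
    Continuous f ∧ headMean f ∈ innerAlgebra N n := by
  induction hf using Submodule.span_induction with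
  | mem f hf =>
    refine ⟨continuous_of_mem_starFunctions hf, ?_⟩
    obtain ⟨C, F, hF, hf⟩ := hf
    have : headMean f = starMean C * F := funext fun τ => by
      simp only [headMean, hf, integral_mul_const, Pi.mul_apply, starMean]
    rw [this]
    exact mul_mem (starMean_mem_innerAlgebra hn C) hF
  | zero =>
    have : headMean (0 : (Fin (N + 1) → Spin n) → ℝ) = 0 := funext fun τ => by simp [headMean]
    exact ⟨continuous_const, this ▸ zero_mem _⟩
  | add f g _ _ hf hg =>
    exact ⟨hf.1.add hg.1, headMean_add hn hf.1 hg.1 ▸ add_mem hf.2 hg.2⟩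
  | smul r f _ hf => exact ⟨hf.1.const_smul r, headMean_smul r f ▸ Subalgebra.smul_mem _ hf.2 r⟩

lemma headMean_mem_innerAlgebra {N n : ℕ} (hn : 2 ≤ n) {f : (Fin (N + 1) → Spin n) → ℝ}
    (hf : f ∈ innerAlgebra (N + 1) n) : headMean f ∈ innerAlgebra N n :=
  (continuous_and_headMean_mem_innerAlgebra hn (innerAlgebra_succ_le_span hf)).2

/-- The difference of the two sides is the mean covariance of `f` and `g` under the spin with
index `0`. -/
lemma spinExpectation_headMean_mul_headMean_le {N n : ℕ} (hn : 2 ≤ n)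
    {f g : (Fin (N + 1) → Spin n) → ℝ} (hf : f ∈ innerAlgebra (N + 1) n)
    (hg : g ∈ innerAlgebra (N + 1) n) :
    spinExpectation N n (headMean f * headMean g) ≤ spinExpectation (N + 1) n (f * g) := by
  have hS : ∀ {f : (Fin (N + 1) → Spin n) → ℝ}, f ∈ Submodule.span ℝ≥0 (starFunctions N n) →
      Continuous f ∧ Continuous (headMean f) := fun hf =>
    (continuous_and_headMean_mem_innerAlgebra hn hf).imp_right continuous_of_mem_innerAlgebra
  have h0 : headMean (0 : (Fin (N + 1) → Spin n) → ℝ) = 0 := funext fun τ => by simp [headMean]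
  replace hf := innerAlgebra_succ_le_span hf
  replace hg := innerAlgebra_succ_le_span hg
  induction hf using Submodule.span_induction with
  | zero => simp [h0, spinExpectation]
  | add f₁ f₂ h₁ h₂ ih₁ ih₂ =>
    have hg' := hS hg
    rw [headMean_add hn (hS h₁).1 (hS h₂).1, add_mul, add_mul,
      spinExpectation_add hn ((hS h₁).2.mul hg'.2) ((hS h₂).2.mul hg'.2),
      spinExpectation_add hn ((hS h₁).1.mul hg'.1) ((hS h₂).1.mul hg'.1)]
    exact add_le_add ih₁ ih₂
  | smul r f _ ih =>
    rw [headMean_smul, smul_mul_assoc, smul_mul_assoc, spinExpectation_smul, spinExpectation_smul]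
    exact mul_le_mul_of_nonneg_left ih r.2
  | mem f hf =>
    induction hg using Submodule.span_induction with
    | zero => simp [h0, spinExpectation]
    | add g₁ g₂ h₁ h₂ ih₁ ih₂ =>
      have hf' := hS (Submodule.subset_span hf)
      rw [headMean_add hn (hS h₁).1 (hS h₂).1, mul_add, mul_add,
        spinExpectation_add hn (hf'.2.mul (hS h₁).2) (hf'.2.mul (hS h₂).2),
        spinExpectation_add hn (hf'.1.mul (hS h₁).1) (hf'.1.mul (hS h₂).1)]
      exact add_le_add ih₁ ih₂
    | smul r g _ ih =>
      rw [headMean_smul, mul_smul_comm, mul_smul_comm, spinExpectation_smul, spinExpectation_smul]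
      exact mul_le_mul_of_nonneg_left ih r.2
    | mem g hg =>
      rw [← spinExpectation_headMean hn ((continuous_of_mem_starFunctions hf).mul
        (continuous_of_mem_starFunctions hg))]
      obtain ⟨A, F, hF, hf⟩ := hf
      obtain ⟨B, G, hG, hg⟩ := hg
      convert spinExpectation_starMean_mul_starMean_le hn A B (mul_mem hF hG) using 2
      · ext τ
        simp only [headMean, hf, hg, integral_mul_const, Pi.mul_apply, starMean]
        ring
      · ext τ
        simp only [headMean, Pi.mul_apply, hf, hg, starMean, starProd_add, ← integral_mul_const]
        refine integral_congr_ae (Filter.Eventually.of_forall fun s => ?_)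
        ring

/-- The second Griffiths inequality on the cone generated by products of inner products, by
integrating out one spin at a time. -/
lemma spinExpectation_mul_spinExpectation_le {N n : ℕ} (hn : 2 ≤ n) {f g : (Fin N → Spin n) → ℝ}
    (hf : f ∈ innerAlgebra N n) (hg : g ∈ innerAlgebra N n) :
    spinExpectation N n f * spinExpectation N n g ≤ spinExpectation N n (f * g) := by
  induction N with
  | zero =>
    rw [spinExpectation, spinExpectation, spinExpectation, Measure.pi_of_empty, integral_dirac,
      integral_dirac, integral_dirac, Pi.mul_apply]
  | succ N ih =>
    rw [← spinExpectation_headMean hn (continuous_of_mem_innerAlgebra hf),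
      ← spinExpectation_headMean hn (continuous_of_mem_innerAlgebra hg)]
    exact (ih (headMean_mem_innerAlgebra hn hf) (headMean_mem_innerAlgebra hn hg)).trans
      (spinExpectation_headMean_mul_headMean_le hn hf hg)

lemma spinCone_le_innerAlgebra {N n : ℕ} {f : (Fin N → Spin n) → ℝ} (hf : f ∈ spinCone N n) :
    f ∈ innerAlgebra N n := by
  have h : Submodule.span ℝ≥0 (range (spinMonomial N n)) ≤
      Subalgebra.toSubmodule (innerAlgebra N n) := by
    refine Submodule.span_le.2 ?_
    rintro _ ⟨m, rfl⟩
    have : spinMonomial N n m = ∏ i : Fin N, ∏ j ∈ Finset.Ioi i, (fun σ : Fin N → Spin n =>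
        inner ℝ (σ i : EuclideanSpace ℝ (Fin n)) (σ j : EuclideanSpace ℝ (Fin n))) ^ m i j := by
      ext σ
      simp [spinMonomial, Finset.prod_apply]
    rw [this, SetLike.mem_coe, Subalgebra.mem_toSubmodule]
    exact prod_mem fun i _ => prod_mem fun j _ => pow_mem (inner_mem_innerAlgebra i j) _
  exact h hf

theorem mainTheorem1 (N n : ℕ) (hn : 2 ≤ n) (f g : (Fin N → Spin n) → ℝ)
    (hf : f ∈ spinCone N n) (hg : g ∈ spinCone N n) :
    0 ≤ spinExpectation N n f ∧
      spinExpectation N n f * spinExpectation N n g ≤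
        spinExpectation N n (fun σ => f σ * g σ) := by
  refine ⟨spinExpectation_nonneg_of_mem_coordAlgebra hn
    (innerAlgebra_le_coordAlgebra (EuclideanSpace.basisFun (Fin n) ℝ)
      (spinCone_le_innerAlgebra hf)), ?_⟩
  exact spinExpectation_mul_spinExpectation_le hn (spinCone_le_innerAlgebra hf)
    (spinCone_le_innerAlgebra hg)
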